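/- Let $m\ge 1$ be an integer, let $F=\mathbb{F}_{2^m}$ be the finite field with $2^m$ elements, and let $F^*=F\setminus\{0\}$. For $a\in F$ let \[ K(a)=\sum_{x\in F^*}(-1)^{\mathrm{Tr}(ax+1/x)}, \] where $\mathrm{Tr}$ is the trace function of $F$ over $\mathbb{F}_2$. Then for every $b\in F$ with $b\neq 1$, \[ K\!\left(\frac{b^3(b^3+b+1)^3}{(1+b)^4}\right)=K\!\left(\frac{b^9(b^3+b+1)}{(1+b)^4}\right). \] -/

import Mathlib

/-- The Kloosterman sum `K(a) = ∑_{x ∈ F*} (-1)^{Tr(a x + 1/x)}` over a finite field `F` of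
characteristic two, where `Tr` is the absolute trace of `F` over `𝔽₂`. It is an integer. The formula
is used for every `a` in `F`, including `a = 0`. -/
noncomputable def kloostermanSum {F : Type*} [Field F] [Fintype F] [DecidableEq F]
    [Algebra (ZMod 2) F] (a : F) : ℤ :=
  ∑ x : F with x ≠ 0, (-1 : ℤ) ^ (Algebra.trace (ZMod 2) F (a * x + 1 / x)).val

section KloostermanThreeIsogeny

variable {F : Type*} [Field F] [Algebra (ZMod 2) F]

theorem odd_finrank_of_trace_one_ne_zero (h1 : Algebra.trace (ZMod 2) F (1 : F) ≠ 0) :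
    Odd (Module.finrank (ZMod 2) F) := by
  rw [← Nat.not_even_iff_odd]
  intro he
  apply h1
  have := Algebra.trace_algebraMap (S := F) (1 : ZMod 2)
  rw [map_one] at this
  rw [this, nsmul_one]
  exact (ZMod.natCast_eq_zero_iff_even).2 he

theorem two_eq_zero_of_algebra_zmod_two : (2 : F) = 0 := by
  have h := map_natCast (algebraMap (ZMod 2) F) 2
  rw [show ((2 : ℕ) : ZMod 2) = 0 from rfl, map_zero] at h
  exact_mod_cast h.symm

theorem charP_two_of_algebra_zmod_two : CharP F 2 :=
  charP_of_injective_algebraMap (algebraMap (ZMod 2) F).injective 2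

theorem sum_range_half_trace (z : F) (k : ℕ) :
    (∑ i ∈ Finset.range k, z ^ 2 ^ (2 * i)) ^ 2 + ∑ i ∈ Finset.range k, z ^ 2 ^ (2 * i) =
      ∑ j ∈ Finset.range (2 * k), z ^ 2 ^ j := by
  have h2 : (2 : F) = 0 := two_eq_zero_of_algebra_zmod_two
  induction k with
  | zero => simp
  | succ k ih =>
    rw [Finset.sum_range_succ, show 2 * (k + 1) = 2 * k + 1 + 1 by ring,
      Finset.sum_range_succ _ (2 * k + 1), Finset.sum_range_succ _ (2 * k), ← ih,
      pow_succ 2 (2 * k), pow_mul z]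
    generalize z ^ 2 ^ (2 * k) = u
    linear_combination ((∑ i ∈ Finset.range k, z ^ 2 ^ (2 * i)) * u) * h2

variable [Fintype F]

theorem trace_zmod_two_sq (x : F) :
    Algebra.trace (ZMod 2) F (x ^ 2) = Algebra.trace (ZMod 2) F x := by
  have h := Algebra.trace_eq_of_algEquiv (FiniteField.frobeniusAlgEquivOfAlgebraic (ZMod 2) F) x
  simpa [ZMod.card] using h

theorem trace_zmod_two_sq_add_self (x : F) :
    Algebra.trace (ZMod 2) F (x ^ 2 + x) = 0 := by
  rw [map_add, trace_zmod_two_sq]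
  exact CharTwo.add_self_eq_zero _

theorem exists_sq_eq_of_algebra_zmod_two (x : F) : ∃ y : F, y ^ 2 = x := by
  have : CharP F 2 := charP_two_of_algebra_zmod_two
  obtain ⟨y, hy⟩ := (FiniteField.isSquare_of_char_two (ringChar.eq F 2) x)
  exact ⟨y, by rw [hy, sq]⟩

/-- In odd degree the half-trace solves the Artin-Schreier equation. -/
theorem exists_artinSchreier_of_trace_one_ne_zero
    (h1 : Algebra.trace (ZMod 2) F (1 : F) ≠ 0) {z : F}
    (hz : Algebra.trace (ZMod 2) F z = 0) : ∃ t : F, t ^ 2 + t = z := by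
  obtain ⟨k, hk⟩ := odd_finrank_of_trace_one_ne_zero h1
  have hs := FiniteField.algebraMap_trace_eq_sum_pow (ZMod 2) F z
  rw [hz, map_zero, Nat.card_zmod, hk] at hs
  have hcard : Fintype.card F = 2 ^ (2 * k + 1) := by
    rw [Module.card_eq_pow_finrank (K := ZMod 2) (V := F), ZMod.card, hk]
  refine ⟨∑ i ∈ Finset.range (k + 1), z ^ 2 ^ (2 * i), ?_⟩
  rw [sum_range_half_trace, show 2 * (k + 1) = 2 * k + 1 + 1 by ring, Finset.sum_range_succ,
    ← hs, ← hcard, FiniteField.pow_card, zero_add]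

theorem exists_cube_eq_of_trace_one_ne_zero
    (h1 : Algebra.trace (ZMod 2) F (1 : F) ≠ 0) (z : F) : ∃ v : F, v ^ 3 = z := by
  obtain ⟨k, hk⟩ := odd_finrank_of_trace_one_ne_zero h1
  have hcard : Fintype.card F = 2 ^ (2 * k + 1) := by
    rw [Module.card_eq_pow_finrank (K := ZMod 2) (V := F), ZMod.card, hk]
  obtain ⟨n, hn⟩ : ∃ n, n * 3 = 2 * (2 ^ (2 * k + 1)) - 1 := by
    have : 3 ∣ 4 ^ (k + 1) - 1 := by simpa using Nat.sub_dvd_pow_sub_pow 4 1 (k + 1)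
    obtain ⟨n, hn⟩ := this
    refine ⟨n, ?_⟩
    rw [mul_comm, ← hn, show 2 * 2 ^ (2 * k + 1) = 4 ^ (k + 1) by
      rw [show 4 = 2 ^ 2 by norm_num, ← pow_mul]; ring]
  refine ⟨z ^ n, ?_⟩
  rw [← pow_mul, hn, ← hcard]
  have hpos : 0 < Fintype.card F := Fintype.card_pos
  rw [show 2 * Fintype.card F - 1 = Fintype.card F + (Fintype.card F - 1) by omega, pow_add,
    FiniteField.pow_card, mul_comm, ← pow_succ, Nat.sub_add_cancel hpos, FiniteField.pow_card]

/-- The 3-isogeny on `x`-coordinates preserves the trace condition. -/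
theorem trace_three_isogeny {c x X : F} (hx : x ≠ 0) (hxc : x + c ≠ 0) (hX : X ≠ 0)
    (h : X = x + c * x / (x + c) ^ 2) :
    Algebra.trace (ZMod 2) F (X + c * (1 + c) ^ 3 / X ^ 2) =
      Algebra.trace (ZMod 2) F (x + c ^ 3 * (1 + c) / x ^ 2) := by
  have h2 : (2 : F) = 0 := two_eq_zero_of_algebra_zmod_two
  obtain ⟨s, hs⟩ := exists_sq_eq_of_algebra_zmod_two (c ^ 2 + c)
  have hX' : X = x * (x + s) ^ 2 / (x + c) ^ 2 := by
    rw [h]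
    field_simp
    grind
  have hxs : x + s ≠ 0 := by
    intro h0
    apply hX
    rw [hX', h0]
    simp
  have e1 : X = x + ((c / (x + c)) ^ 2 + c / (x + c)) := by
    rw [h]
    field_simp
    grind
  have e2 : c * (1 + c) ^ 3 / X ^ 2 =
      (c * s / x + ((s / (x + s)) ^ 2 + s / (x + s))) ^ 2 := by
    have : (1 + c) * s / X = c * s / x + ((s / (x + s)) ^ 2 + s / (x + s)) := by
      rw [hX']
      field_simp
      grind
    rw [← this, div_pow, mul_pow, hs]
    ring
  have e3 : c ^ 3 * (1 + c) / x ^ 2 = (c * s / x) ^ 2 := by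
    rw [div_pow, mul_pow, hs]
    ring
  rw [map_add, e2, trace_zmod_two_sq, map_add, trace_zmod_two_sq_add_self, e1, map_add,
    trace_zmod_two_sq_add_self, map_add, e3, trace_zmod_two_sq]
  simp

theorem trace_eq_of_three_isogeny_eq {c x y : F} (hc : c ≠ 0) (hx : x ≠ 0) (hxc : x + c ≠ 0)
    (hyc : y + c ≠ 0) (hxy : x ≠ y)
    (h : x + c * x / (x + c) ^ 2 = y + c * y / (y + c) ^ 2) :
    Algebra.trace (ZMod 2) F (x + c ^ 3 * (1 + c) / x ^ 2) = Algebra.trace (ZMod 2) F c := by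
  have h2 : (2 : F) = 0 := two_eq_zero_of_algebra_zmod_two
  have hsub : x - y ≠ 0 := sub_ne_zero.2 hxy
  have key : (x + c) ^ 2 * (y + c) ^ 2 + c * (x + c) * (y + c) + c ^ 2 * (x + y) = 0 := by
    field_simp at h
    apply mul_left_cancel₀ hsub
    grind
  have hsol : (x + c) ^ 3 / x ^ 2 =
      ((y + c) * (x + c) ^ 2 / (c * x)) ^ 2 + (y + c) * (x + c) ^ 2 / (c * x) := by
    field_simp
    grind
  have htr := trace_zmod_two_sq_add_self ((y + c) * (x + c) ^ 2 / (c * x))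
  rw [← hsol] at htr
  have e : (x + c) ^ 3 / x ^ 2 =
      (x + c ^ 3 * (1 + c) / x ^ 2) + c + ((c ^ 2 / x) ^ 2 + c ^ 2 / x) := by
    field_simp
    grind
  rw [e, map_add, trace_zmod_two_sq_add_self, add_zero, map_add] at htr
  exact CharTwo.add_eq_zero.1 htr

theorem exists_three_isogeny_eq {c X : F} (hc : c ≠ 0) (hX : X ≠ 0)
    (h1 : Algebra.trace (ZMod 2) F (1 : F) ≠ 0)
    (h : Algebra.trace (ZMod 2) F (X + c * (1 + c) ^ 3 / X ^ 2) ≠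
      Algebra.trace (ZMod 2) F c) :
    ∃ x : F, x ≠ 0 ∧ x + c ≠ 0 ∧ X = x + c * x / (x + c) ^ 2 := by
  have h2 : (2 : F) = 0 := two_eq_zero_of_algebra_zmod_two
  have htr : Algebra.trace (ZMod 2) F ((1 + X + c) ^ 3 / X ^ 2) = 0 := by
    have e : (1 + X + c) ^ 3 / X ^ 2 = (X + c * (1 + c) ^ 3 / X ^ 2) + c + 1 +
        (((1 + c) ^ 2 / X) ^ 2 + (1 + c) ^ 2 / X) := by
      field_simp
      grind
    rw [e, map_add, trace_zmod_two_sq_add_self, add_zero, map_add, map_add]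
    revert h h1
    generalize Algebra.trace (ZMod 2) F (X + c * (1 + c) ^ 3 / X ^ 2) = u
    generalize Algebra.trace (ZMod 2) F c = v
    generalize Algebra.trace (ZMod 2) F (1 : F) = w
    revert u v w
    decide
  obtain ⟨t, ht, ht0⟩ : ∃ t : F, t ^ 2 + t = (1 + X + c) ^ 3 / X ^ 2 ∧ t ≠ 0 := by
    obtain ⟨t, ht⟩ := exists_artinSchreier_of_trace_one_ne_zero h1 htr
    by_cases ht0 : t = 0
    · exact ⟨1, by rw [← ht, ht0]; linear_combination h2, one_ne_zero⟩
    · exact ⟨t, ht, ht0⟩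
  obtain ⟨v, hv⟩ := exists_cube_eq_of_trace_one_ne_zero h1 (t * X)
  have hv0 : v ≠ 0 := by
    rintro rfl
    exact mul_ne_zero ht0 hX (by rw [← hv]; ring)
  have hcardano : (v ^ 3) ^ 2 + X * v ^ 3 + (1 + X + c) ^ 3 = 0 := by
    rw [hv]
    field_simp at ht
    grind
  obtain ⟨r, hr⟩ : ∃ r, r = v + (1 + X + c) / v := ⟨_, rfl⟩
  have hroot : r ^ 3 + (1 + X + c) * r + X = 0 := by
    rw [hr]
    field_simp
    grind
  have hr1 : r + 1 ≠ 0 := by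
    intro h0
    apply hc
    grind
  have hr0 : r ≠ 0 := by
    rintro rfl
    apply hX
    simpa using hroot
  refine ⟨c / (r + 1) + c, ?_, ?_, ?_⟩
  · have : c / (r + 1) + c = c * r / (r + 1) := by
      field_simp
      grind
    rw [this]
    positivity
  · have : c / (r + 1) + c + c = c / (r + 1) := by grind
    rw [this]
    positivity
  · have : c / (r + 1) + c + c = c / (r + 1) := by grind
    rw [this]
    field_simp
    grind

variable [DecidableEq F]

theorem kloostermanSum_eq_sum_trace_add_div_sq (a : F) :
    kloostermanSum a =
      ∑ x : F with x ≠ 0, (-1 : ℤ) ^ (Algebra.trace (ZMod 2) F (x + a / x ^ 2)).val := by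
  have h2 : (2 : F) = 0 := two_eq_zero_of_algebra_zmod_two
  symm
  refine Finset.sum_bij (fun x _ => 1 / x ^ 2) ?_ ?_ ?_ ?_
  · intro x hx
    simpa using hx
  · intro x hx y hy hxy
    simp only [one_div, inv_inj] at hxy
    have : (x - y) ^ 2 = 0 := by linear_combination hxy + (y ^ 2 - x * y) * h2
    exact sub_eq_zero.1 (pow_eq_zero_iff two_ne_zero |>.1 this)
  · intro z hz
    obtain ⟨y, hy⟩ := exists_sq_eq_of_algebra_zmod_two z⁻¹
    refine ⟨y, ?_, by simp [hy]⟩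
    simp only [Finset.mem_filter, Finset.mem_univ, true_and] at hz ⊢
    rintro rfl
    exact inv_ne_zero hz (by rw [← hy]; ring)
  · intro x hx
    rw [one_div_one_div, map_add, map_add, trace_zmod_two_sq, add_comm, mul_one_div]

theorem kloostermanSum_eq_of_card_eq {a a' : F} (t : ZMod 2)
    (h : ((Finset.univ.filter fun x : F => x ≠ 0).filter
        fun x => Algebra.trace (ZMod 2) F (x + a / x ^ 2) ≠ t).card =
      ((Finset.univ.filter fun x : F => x ≠ 0).filter
        fun x => Algebra.trace (ZMod 2) F (x + a' / x ^ 2) ≠ t).card) :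
    kloostermanSum a = kloostermanSum a' := by
  have key (d : F) : kloostermanSum d = ∑ x : F with x ≠ 0, (-1 : ℤ) ^ t.val -
      2 * (-1) ^ t.val * ((Finset.univ.filter fun x : F => x ≠ 0).filter
        fun x => Algebra.trace (ZMod 2) F (x + d / x ^ 2) ≠ t).card := by
    rw [kloostermanSum_eq_sum_trace_add_div_sq, Finset.card_filter, Nat.cast_sum, Finset.mul_sum,
      ← Finset.sum_sub_distrib]
    refine Finset.sum_congr rfl fun x _ => ?_
    generalize Algebra.trace (ZMod 2) F (x + d / x ^ 2) = u
    clear h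
    revert u t
    decide
  rw [key, key, h]

theorem trace_three_torsion_translate {c x : F} (hx : x ≠ 0) (hc : c ≠ 0)
    (h : x = c ∨ x + c * x / (x + c) ^ 2 = 0) :
    Algebra.trace (ZMod 2) F (x + c ^ 3 * (1 + c) / x ^ 2) = Algebra.trace (ZMod 2) F c := by
  have h2 : (2 : F) = 0 := two_eq_zero_of_algebra_zmod_two
  by_cases hxc : x = c
  · subst hxc
    have : x + x ^ 3 * (1 + x) / x ^ 2 = x ^ 2 := by
      field_simp
      grind
    rw [this, trace_zmod_two_sq]
  · have h := h.resolve_left hxc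
    have hxc' : x + c ≠ 0 := by grind
    have hsq : x ^ 2 = c ^ 2 + c := by
      field_simp at h
      grind
    have : c ^ 3 * (1 + c) / x ^ 2 = c ^ 2 := by
      have h0 : c ^ 2 + c ≠ 0 := hsq ▸ pow_ne_zero 2 hx
      rw [hsq, div_eq_iff h0]
      ring
    have e := trace_zmod_two_sq (x + c)
    rw [this, map_add, trace_zmod_two_sq, ← map_add, ← e]
    congr 1
    grind

theorem mapsTo_three_isogeny {c x : F} (hx : x ≠ 0) (hc : c ≠ 0)
    (h : Algebra.trace (ZMod 2) F (x + c ^ 3 * (1 + c) / x ^ 2) ≠ Algebra.trace (ZMod 2) F c) :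
    x + c ≠ 0 ∧ x + c * x / (x + c) ^ 2 ≠ 0 := by
  have h2 : (2 : F) = 0 := two_eq_zero_of_algebra_zmod_two
  refine ⟨fun h0 => h (trace_three_torsion_translate hx hc (Or.inl ?_)),
    fun h0 => h (trace_three_torsion_translate hx hc (Or.inr h0))⟩
  linear_combination h0 - c * h2

theorem card_trace_ne_le {c : F} (hc : c ≠ 0) :
    ((Finset.univ.filter fun x : F => x ≠ 0).filter fun x =>
        Algebra.trace (ZMod 2) F (x + c ^ 3 * (1 + c) / x ^ 2) ≠ Algebra.trace (ZMod 2) F c).card ≤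
      ((Finset.univ.filter fun x : F => x ≠ 0).filter fun x =>
        Algebra.trace (ZMod 2) F (x + c * (1 + c) ^ 3 / x ^ 2) ≠
          Algebra.trace (ZMod 2) F c).card := by
  refine Finset.card_le_card_of_injOn (fun x => x + c * x / (x + c) ^ 2) ?_ ?_
  · intro x hx
    simp only [Finset.coe_filter, Finset.mem_filter, Finset.mem_univ, true_and,
      Set.mem_ofPred_eq] at hx ⊢
    obtain ⟨hxc, hX⟩ := mapsTo_three_isogeny hx.1 hc hx.2
    exact ⟨hX, by rw [trace_three_isogeny hx.1 hxc hX rfl]; exact hx.2⟩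
  · intro x hx y hy hxy
    simp only [Finset.coe_filter, Finset.mem_filter, Finset.mem_univ, true_and,
      Set.mem_ofPred_eq] at hx hy
    by_contra hne
    exact hx.2 (trace_eq_of_three_isogeny_eq hc hx.1 (mapsTo_three_isogeny hx.1 hc hx.2).1
      (mapsTo_three_isogeny hy.1 hc hy.2).1 hne hxy)

theorem card_trace_ne_ge_of_trace_one_ne_zero {c : F} (hc : c ≠ 0)
    (h1 : Algebra.trace (ZMod 2) F (1 : F) ≠ 0) :
    ((Finset.univ.filter fun x : F => x ≠ 0).filter fun x =>
        Algebra.trace (ZMod 2) F (x + c * (1 + c) ^ 3 / x ^ 2) ≠ Algebra.trace (ZMod 2) F c).card ≤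
      ((Finset.univ.filter fun x : F => x ≠ 0).filter fun x =>
        Algebra.trace (ZMod 2) F (x + c ^ 3 * (1 + c) / x ^ 2) ≠
          Algebra.trace (ZMod 2) F c).card := by
  refine Finset.card_le_card_of_surjOn (fun x => x + c * x / (x + c) ^ 2) ?_
  intro X hX
  simp only [Finset.coe_filter, Finset.mem_filter, Finset.mem_univ, true_and,
    Set.mem_ofPred_eq] at hX
  obtain ⟨x, hx, hxc, h⟩ := exists_three_isogeny_eq hc hX.1 h1 hX.2
  refine ⟨x, ?_, h.symm⟩
  simp only [Finset.coe_filter, Finset.mem_filter, Finset.mem_univ, true_and, Set.mem_ofPred_eq]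
  exact ⟨hx, by rw [← trace_three_isogeny hx hxc hX.1 h]; exact hX.2⟩

/-- The Kloosterman sum identity of Helleseth and Zinoviev. -/
theorem kloostermanSum_three_isogeny (c : F) :
    kloostermanSum (c ^ 3 * (1 + c)) = kloostermanSum (c * (1 + c) ^ 3) := by
  have h2 : (2 : F) = 0 := two_eq_zero_of_algebra_zmod_two
  by_cases hc : c = 0
  · simp [hc]
  by_cases hc1 : 1 + c = 0
  · simp [hc1]
  refine kloostermanSum_eq_of_card_eq (Algebra.trace (ZMod 2) F c) ?_
  refine le_antisymm (card_trace_ne_le hc) ?_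
  by_cases h1 : Algebra.trace (ZMod 2) F (1 : F) = 0
  · have h := card_trace_ne_le hc1
    rw [show 1 + (1 + c) = c by linear_combination h2, map_add, h1, zero_add] at h
    simpa only [mul_comm] using h
  · exact card_trace_ne_ge_of_trace_one_ne_zero hc h1

end KloostermanThreeIsogeny

theorem corollary2 {F : Type*} [Field F] [Fintype F] [DecidableEq F] [Algebra (ZMod 2) F]
    (b : F) (hb : b ≠ 1) :
    kloostermanSum (b ^ 3 * (b ^ 3 + b + 1) ^ 3 / (1 + b) ^ 4) =
      kloostermanSum (b ^ 9 * (b ^ 3 + b + 1) / (1 + b) ^ 4) := by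
  have h2 : (2 : F) = 0 := two_eq_zero_of_algebra_zmod_two
  have hb1 : 1 + b ≠ 0 := by
    intro h
    exact hb (by linear_combination h - h2)
  have hc : 1 + (b ^ 3 + b + 1) / (1 + b) = b ^ 3 / (1 + b) := by
    field_simp
    linear_combination (1 + b) * h2
  have h := kloostermanSum_three_isogeny ((b ^ 3 + b + 1) / (1 + b))
  rw [hc] at h
  convert h using 2 <;> field_simp
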